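/- **Conventions.** Let $U\ge 0$ be a random variable with Laplace transform $\varphi(z)=E e^{-zU}$, $\operatorname{Re} z\ge 0$. CF means characteristic function of a probability law on $\mathbf R$; a CF $\omega$ is infinitely divisible (ID) if for each integer $n\ge 1$ it is the $n$-th power of a CF. Whenever $e^{-\psi}$ is an ID CF, $\psi:\mathbf R\to\mathbf C$ is taken continuous with $\psi(0)=0$, i.e. $\psi=-\log\omega$ for the distinguished logarithm; $e^{-\psi}$ is semi-stable if moreover $a\,\psi(t)=\psi(bt)-ict$ for all $t$, for some $a>0$, $a\ne 1$, $b>0$, $c\in\mathbf R$. A CF $f$ is $\varphi$-ID if $f(t)=\lim_n\varphi\{a_n(1-f_n(t))\}$ for all $t$, for some $a_n>0$ and CFs $f_n$; it is $\varphi$-semi-stable if $f=\varphi\{\psi\}$ for some semi-stable $e^{-\psi}$. For a CF $g$, positive integers $n_k\to\infty$, $a_k>0$ and $b_k\in\mathbf R$ put $g_k(t)=g(t/a_k)e^{-itb_k}$. The CF $g$ belongs to the domain of partial attraction $\mathrm{DPA}(\omega)$ if for some such sequences $\exp\{-n_k(1-g_k(t))\}\to\omega(t)$ for all $t\in\mathbf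 R$, and to the domain of partial $\varphi$-attraction $\mathrm{DP}\varphi\text{-}\mathrm A(f)$ if for some such sequences $\varphi\{n_k(1-g_k(t))\}\to f(t)$ for all $t\in\mathbf R$. **Theorem.** 1. For every $\varphi$-ID CF $f$, $\mathrm{DP}\varphi\text{-}\mathrm A(f)=\bigcup_\psi \mathrm{DPA}(e^{-\psi})$, the union being over all $\psi$ such that $e^{-\psi}$ is an ID CF and $f=\varphi\{\psi\}$. 2. Let $f=\varphi\{\psi\}$ be $\varphi$-ID, where $e^{-\psi}$ is an ID CF, and suppose that $\psi=\varphi^{-1}(f)$ is well defined, i.e. $\psi$ is the only function with these two properties. Then $\mathrm{DP}\varphi\text{-}\mathrm A(f)=\mathrm{DPA}(e^{-\psi})$. 3. The same holds for semi-stable laws: if $f=\varphi\{\psi\}$ is $\varphi$-semi-stable, where $e^{-\psi}$ is a semi-stable CF, and $\psi$ is the only function such that $e^{-\psi}$ is an ID CF and $f=\varphi\{\psi\}$, then $\mathrm{DP}\varphi\text{-}\mathrm A(f)=\mathrm{DPA}(e^{-\psi})$. -/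

import Mathlib

open MeasureTheory Filter Topology
open scoped NNReal

noncomputable section

namespace PhiAttraction

/-- The Laplace transform `φ(z) = E exp (-z U)` of a law `μ` of a random variable `U ≥ 0`,
as a function on the closed right half-plane `Re z ≥ 0`. -/
def laplace (μ : Measure ℝ≥0) (z : ℂ) : ℂ :=
  ∫ u : ℝ≥0, Complex.exp (-(z * ((u : ℝ) : ℂ))) ∂μ

/-- `f` is the characteristic function of a probability law on the real line. -/
def IsCF (f : ℝ → ℂ) : Prop :=
  ∃ P : Measure ℝ, IsProbabilityMeasure P ∧ ∀ t, f t = charFun P t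

/-- `ω` is an infinitely divisible characteristic function. -/
def IsID (ω : ℝ → ℂ) : Prop :=
  IsCF ω ∧ ∀ n : ℕ, 1 ≤ n → ∃ h : ℝ → ℂ, IsCF h ∧ ∀ t, ω t = h t ^ n

/-- `ψ = -log ω` for an infinitely divisible `ω = exp (-ψ)`; the logarithm is the
distinguished one, that is, `ψ` is continuous and `ψ 0 = 0`. -/
def IsIDExponent (ψ : ℝ → ℂ) : Prop :=
  Continuous ψ ∧ ψ 0 = 0 ∧ IsID (fun t => Complex.exp (-ψ t))

/-- `ψ = -log ω` for a semi-stable `ω`: it is infinitely divisible, and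
`ω(t)^a = ω(b t) exp (i c t)` for some `a > 0`, `a ≠ 1`, `b > 0` and real `c`
(the power being `exp (-a ψ)`). -/
def IsSemistableExponent (ψ : ℝ → ℂ) : Prop :=
  IsIDExponent ψ ∧ ∃ a b c : ℝ, 0 < a ∧ a ≠ 1 ∧ 0 < b ∧
    ∀ t : ℝ, (a : ℂ) * ψ t = ψ (b * t) - Complex.I * c * t

/-- `f` is `φ`-infinitely divisible: a characteristic function which is the limit of
`φ(aₙ (1 - fₙ(t)))` with positive `aₙ` and characteristic functions `fₙ`. -/
def IsPhiID (μ : Measure ℝ≥0) (f : ℝ → ℂ) : Prop :=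
  IsCF f ∧ ∃ (a : ℕ → ℝ) (h : ℕ → ℝ → ℂ), (∀ n, 0 < a n) ∧ (∀ n, IsCF (h n)) ∧
    ∀ t, Tendsto (fun n => laplace μ ((a n : ℂ) * (1 - h n t))) atTop (𝓝 (f t))

/-- `f` is `φ`-semi-stable: a characteristic function `φ(-log ω)` with `ω` semi-stable. -/
def IsPhiSemistable (μ : Measure ℝ≥0) (f : ℝ → ℂ) : Prop :=
  IsCF f ∧ ∃ ψ : ℝ → ℂ, IsSemistableExponent ψ ∧ ∀ t, f t = laplace μ (ψ t)

/-- The normed and centred characteristic function `g(t / a) exp (-i t b)`. -/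
def normed (g : ℝ → ℂ) (a b : ℝ) (t : ℝ) : ℂ :=
  g (t / a) * Complex.exp (-(Complex.I * t * b))

/-- The domain of partial attraction of `ω`. -/
def DPA (ω : ℝ → ℂ) : Set (ℝ → ℂ) :=
  {g | IsCF g ∧ ∃ (n : ℕ → ℕ) (a b : ℕ → ℝ),
    (∀ k, 0 < n k) ∧ Tendsto n atTop atTop ∧ (∀ k, 0 < a k) ∧
    ∀ t, Tendsto (fun k => Complex.exp (-((n k : ℂ) * (1 - normed g (a k) (b k) t))))
      atTop (𝓝 (ω t))}

/-- The domain of partial `φ`-attraction of `f`. -/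
def DPPhiA (μ : Measure ℝ≥0) (f : ℝ → ℂ) : Set (ℝ → ℂ) :=
  {g | IsCF g ∧ ∃ (n : ℕ → ℕ) (a b : ℕ → ℝ),
    (∀ k, 0 < n k) ∧ Tendsto n atTop atTop ∧ (∀ k, 0 < a k) ∧
    ∀ t, Tendsto (fun k => laplace μ ((n k : ℂ) * (1 - normed g (a k) (b k) t)))
      atTop (𝓝 (f t))}

/-- `ψ` represents `f`: `f = φ(ψ)` and `exp (-ψ)` is infinitely divisible. -/
def Represents (μ : Measure ℝ≥0) (ψ f : ℝ → ℂ) : Prop :=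
  IsIDExponent ψ ∧ ∀ t, f t = laplace μ (ψ t)

/-- `φ⁻¹(f)` is well defined: `f` has at most one representation `f = φ(ψ)` with
`exp (-ψ)` infinitely divisible. -/
def HasUniquePhiInverse (μ : Measure ℝ≥0) (f : ℝ → ℂ) : Prop :=
  ∀ ψ₁ ψ₂ : ℝ → ℂ, Represents μ ψ₁ f → Represents μ ψ₂ f → ψ₁ = ψ₂

end PhiAttraction

end

noncomputable section

namespace PhiAttraction

/-! Everything is read off the exponents `z_k = n_k (1 - g_k)`, which have nonnegative real part,
where `φ` is sequentially continuous. No inverse of `φ` is needed: compactness of the exponents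
replaces it.

If `exp (-z_k)` converges to `exp (-ψ)`, then `z_k` converges to `ψ`
(`tendsto_exponent_of_tendsto_exp`), hence `φ(z_k)` converges to `φ(ψ)`.

Conversely, `φ(z_k)` is the average over `U` of the compound Poisson characteristic functions `exp
(-u z_k)`. Convergence to a characteristic function makes averaged tail bounds small. Unless `U = 0`
almost surely, a Markov-type selection in an interval `[u₀, u₁]` of positive mass, with `u₀ > 0`,
gives times `u_k` at which the laws are tight (`exists_tight_of_tendsto_laplace`). Tightness makes
the exponents relatively compact (`exists_subseq_exponent_tendsto_of_tight`), and a subsequential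
limit `ψ` is an infinitely divisible exponent with `φ(ψ) = f`. If `U = 0` almost surely, then `f =
1` and `ψ = 0` serves for every `g`. Uniqueness of `ψ` collapses the union. -/

theorem IsCF.continuous {f : ℝ → ℂ} (hf : IsCF f) : Continuous f := by
  obtain ⟨P, hP, h⟩ := hf
  rw [show f = charFun P from funext h]
  fun_prop

theorem IsCF.apply_zero {f : ℝ → ℂ} (hf : IsCF f) : f 0 = 1 := by
  obtain ⟨P, hP, h⟩ := hf
  simp [h]

theorem IsCF.norm_le_one {f : ℝ → ℂ} (hf : IsCF f) (t : ℝ) : ‖f t‖ ≤ 1 := by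
  obtain ⟨P, hP, h⟩ := hf
  rw [h]
  exact norm_charFun_le_one t

theorem IsCF.re_le_one {f : ℝ → ℂ} (hf : IsCF f) (t : ℝ) : (f t).re ≤ 1 :=
  (Complex.re_le_norm _).trans (hf.norm_le_one t)

/-! ### Operations on characteristic functions, and compound Poisson laws -/

theorem isCF_one : IsCF fun _ => 1 :=
  ⟨Measure.dirac 0, inferInstance, fun t => by simp [charFun_dirac]⟩

theorem IsCF.mul {f g : ℝ → ℂ} (hf : IsCF f) (hg : IsCF g) : IsCF fun t => f t * g t := by
  obtain ⟨P, hP, h⟩ := hf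
  obtain ⟨Q, hQ, h'⟩ := hg
  exact ⟨P.conv Q, inferInstance, fun t => by simp only [charFun_conv, h, h']⟩

theorem IsCF.pow {f : ℝ → ℂ} (hf : IsCF f) (n : ℕ) : IsCF fun t => f t ^ n := by
  induction n with
  | zero => simpa using isCF_one
  | succ n ih => simpa [pow_succ] using ih.mul hf

theorem charFun_smul_add_smul (P Q : Measure ℝ) [IsFiniteMeasure P] [IsFiniteMeasure Q]
    (a b : ℝ≥0) (t : ℝ) :
    charFun (a • P + b • Q) t = a * charFun P t + b * charFun Q t := by
  simp only [charFun_eq_integral_innerProbChar]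
  rw [integral_add_measure (BoundedContinuousFunction.integrable _ _)
    (BoundedContinuousFunction.integrable _ _), integral_smul_nnreal_measure,
    integral_smul_nnreal_measure]
  simp [NNReal.smul_def]

theorem IsCF.mix {f g : ℝ → ℂ} (hf : IsCF f) (hg : IsCF g) {p : ℝ} (hp : 0 ≤ p) (hp1 : p ≤ 1) :
    IsCF fun t => (1 - p) * f t + p * g t := by
  obtain ⟨P, hP, h⟩ := hf
  obtain ⟨Q, hQ, h'⟩ := hg
  lift p to ℝ≥0 using hp
  have hp1' : p ≤ 1 := by exact_mod_cast hp1
  refine ⟨(1 - p) • P + p • Q, ⟨?_⟩, fun t => ?_⟩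
  · simp only [Measure.coe_add, Pi.add_apply, Measure.smul_apply, measure_univ]
    simp only [ENNReal.smul_def, smul_eq_mul, mul_one]
    rw [← ENNReal.coe_add, tsub_add_cancel_of_le hp1']
    rfl
  · simp only [charFun_smul_add_smul, h, h', NNReal.coe_sub hp1']
    simp

theorem IsCF.normed {g : ℝ → ℂ} (hg : IsCF g) (a b : ℝ) : IsCF (normed g a b) := by
  obtain ⟨P, hP, h⟩ := hg
  have hm : IsProbabilityMeasure (P.map (a⁻¹ * ·)) :=
    Measure.isProbabilityMeasure_map (by fun_prop)
  refine ⟨(P.map (a⁻¹ * ·)).conv (Measure.dirac (-b)), inferInstance, fun t => ?_⟩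
  rw [charFun_conv, charFun_map_mul, charFun_dirac, PhiAttraction.normed, h]
  congr 2
  · ring
  · simp; ring

/-- **Lévy's continuity theorem**, with the limit only assumed continuous at `0`. -/
theorem isCF_of_tendsto {h : ℕ → ℝ → ℂ} {f : ℝ → ℂ} (hh : ∀ n, IsCF (h n))
    (hf : ContinuousAt f 0) (hlim : ∀ t, Tendsto (fun n => h n t) atTop (𝓝 (f t))) : IsCF f := by
  choose P hP hPh using hh
  have hlim' : ∀ t, Tendsto (fun n => charFun (P n) t) atTop (𝓝 (f t)) := fun t => by
    simpa only [hPh] using hlim t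
  have htight := isTightMeasureSet_of_tendsto_charFun hf hlim'
  let Q : ℕ → ProbabilityMeasure ℝ := fun n => ⟨P n, hP n⟩
  have hcomp : IsCompact (closure (Set.range Q)) := by
    apply isCompact_closure_of_isTightMeasureSet
    convert htight using 1
    ext m
    constructor
    · rintro ⟨_, ⟨n, rfl⟩, rfl⟩
      exact ⟨n, rfl⟩
    · rintro ⟨n, rfl⟩
      exact ⟨Q n, ⟨n, rfl⟩, rfl⟩
  obtain ⟨Q₀, -, σ, hσ, hlimQ⟩ :=
    hcomp.tendsto_subseq (x := Q) (fun n => subset_closure ⟨n, rfl⟩)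
  refine ⟨Q₀, inferInstance, fun t => ?_⟩
  exact tendsto_nhds_unique ((hlim' t).comp hσ.tendsto_atTop)
    (ProbabilityMeasure.tendsto_iff_tendsto_charFun.1 hlimQ t)

/-- The compound Poisson law with jump law of characteristic function `g`. -/
theorem IsCF.compoundPoisson {g : ℝ → ℂ} (hg : IsCF g) {c : ℝ} (hc : 0 ≤ c) :
    IsCF fun t => Complex.exp (-(c * (1 - g t))) := by
  -- The approximants are `m`-th powers of the mixture `(1 - c/m) + (c/m) g` with `m = n + N + 1`;
  -- taking `N ≥ c` keeps the weight `c/m` at most `1`.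
  obtain ⟨N, hN⟩ := exists_nat_ge c
  have hg' := hg.continuous
  refine isCF_of_tendsto (h := fun n t => (((1 - (c / (n + N + 1 : ℕ) : ℝ) : ℂ)) * 1 +
    ((c / (n + N + 1 : ℕ) : ℝ) : ℂ) * g t) ^ (n + N + 1)) (fun n => ?_) ?_ fun t => ?_
  · refine (isCF_one.mix hg (by positivity) ?_).pow _
    rw [div_le_one (by positivity)]
    push_cast
    linarith [Nat.cast_nonneg (α := ℝ) n]
  · exact Continuous.continuousAt (by fun_prop)
  · have h := (Complex.tendsto_one_add_div_pow_exp (-(c * (1 - g t)))).comp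
      (tendsto_add_atTop_nat (N + 1))
    refine h.congr fun n => ?_
    simp only [Function.comp, add_assoc]
    congr 1
    push_cast
    ring

/-! ### Uniform estimates for characteristic functions -/

/-- Characteristic functions of a tight family are uniformly equicontinuous. -/
theorem uniformEquicontinuous_charFun {P : ℕ → Measure ℝ} [∀ k, IsProbabilityMeasure (P k)]
    (hP : IsTightMeasureSet (Set.range P)) {ε : ℝ} (hε : 0 < ε) :
    ∃ δ > 0, ∀ k s t, |s - t| < δ → ‖charFun (P k) s - charFun (P k) t‖ ≤ ε := by
  rw [isTightMeasureSet_iff_exists_isCompact_measure_compl_le] at hP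
  -- Off `K` the integrand is at most `2`, so mass `ε / 4` costs `ε / 2`; the other half is spent on
  -- `K`.
  obtain ⟨K, hK, hPK⟩ := hP (ENNReal.ofReal (ε / 4)) (by simpa using hε)
  obtain ⟨R, hR⟩ := hK.isBounded.exists_norm_le
  have hR' : 0 < max R 1 := lt_max_of_lt_right one_pos
  refine ⟨ε / 2 / max R 1, by positivity, fun k s t hst => ?_⟩
  have hKm := hK.measurableSet
  have hint : ∀ r : ℝ, Integrable (fun x : ℝ => Complex.exp (r * x * Complex.I)) (P k) := by
    intro r
    refine Integrable.of_bound (C := 1) (by fun_prop) (ae_of_all _ fun x => ?_)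
    rw [show (r * x * Complex.I : ℂ) = ((r * x : ℝ) : ℂ) * Complex.I by push_cast; ring,
      Complex.norm_exp_ofReal_mul_I]
  have hpt : ∀ x : ℝ, ‖Complex.exp (s * x * Complex.I) - Complex.exp (t * x * Complex.I)‖
      ≤ min 2 (|s - t| * |x|) := by
    intro x
    have e : Complex.exp (s * x * Complex.I) - Complex.exp (t * x * Complex.I) =
        Complex.exp ((t * x : ℝ) * Complex.I) *
          (Complex.exp (Complex.I * ((s - t) * x : ℝ)) - 1) := by
      rw [mul_sub, ← Complex.exp_add]
      push_cast
      ring_nf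
    rw [e, norm_mul, Complex.norm_exp_ofReal_mul_I, one_mul, le_min_iff]
    constructor
    · refine (norm_sub_le _ _).trans ?_
      rw [mul_comm Complex.I, Complex.norm_exp_ofReal_mul_I, norm_one]
      norm_num
    · refine (Real.norm_exp_I_mul_ofReal_sub_one_le).trans ?_
      rw [Real.norm_eq_abs, abs_mul]
  rw [charFun_apply_real, charFun_apply_real, ← integral_sub (hint s) (hint t)]
  have hind : Integrable (fun x => ε / 2 + Set.indicator Kᶜ (fun _ => (2 : ℝ)) x) (P k) :=
    (integrable_const _).add ((integrable_const _).indicator hKm.compl)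
  refine (norm_integral_le_of_norm_le hind (ae_of_all _ fun x => ?_)).trans ?_
  · refine (hpt x).trans ?_
    by_cases hx : x ∈ K
    · have h1 : |x| ≤ max R 1 := (hR x hx).trans (le_max_left _ _)
      have h2 : |s - t| * |x| ≤ ε / 2 := by
        calc |s - t| * |x| ≤ ε / 2 / max R 1 * max R 1 := by gcongr
          _ = ε / 2 := by field_simp
      simpa [hx] using Or.inr h2
    · have : (2 : ℝ) ≤ ε / 2 + 2 := by linarith
      simpa [hx] using Or.inl this
  · rw [integral_add (integrable_const _) ((integrable_const _).indicator hKm.compl),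
      integral_indicator_const _ hKm.compl]
    have h3 : (P k).real Kᶜ ≤ ε / 4 :=
      ENNReal.toReal_le_of_le_ofReal (by positivity) (hPK _ ⟨k, rfl⟩)
    simp
    linarith

/-- Integrates `1 - cos 2x = 2 (1 - cos x) (1 + cos x) ≤ 4 (1 - cos x)`. Iterated, it carries
control near the origin to any bounded interval. -/
theorem IsCF.one_sub_re_two_mul_le {g : ℝ → ℂ} (hg : IsCF g) (t : ℝ) :
    1 - (g (2 * t)).re ≤ 4 * (1 - (g t).re) := by
  obtain ⟨P, hP, h⟩ := hg
  have hint : ∀ r : ℝ, Integrable (fun x : ℝ => Complex.exp (r * x * Complex.I)) P := by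
    intro r
    refine Integrable.of_bound (C := 1) (by fun_prop) (ae_of_all _ fun x => ?_)
    rw [← Complex.ofReal_mul, Complex.norm_exp_ofReal_mul_I]
  have hre : ∀ r : ℝ, 1 - (g r).re = ∫ x : ℝ, (1 - Real.cos (r * x)) ∂P := by
    intro r
    have hc : Integrable (fun x : ℝ => Real.cos (r * x)) P :=
      Integrable.of_bound (C := 1) (by fun_prop) (ae_of_all _ fun x => Real.abs_cos_le_one _)
    rw [integral_sub (integrable_const _) hc, h, charFun_apply_real]
    have := integral_re (𝕜 := ℂ) (hint r)
    simp only [RCLike.re_eq_complex_re] at this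
    rw [← this]
    simp [← Complex.ofReal_mul, Complex.exp_ofReal_mul_I_re]
  rw [hre, hre, ← integral_const_mul]
  have hc : ∀ r : ℝ, Integrable (fun x : ℝ => 1 - Real.cos (r * x)) P := fun r =>
    (integrable_const _).sub
      (Integrable.of_bound (C := 1) (by fun_prop) (ae_of_all _ fun x => Real.abs_cos_le_one _))
  refine integral_mono (hc _) ((hc _).const_mul 4) fun x => ?_
  simp only
  rw [mul_assoc, Real.cos_two_mul]
  nlinarith [sq_nonneg (Real.cos (t * x) - 1)]

theorem IsCF.one_sub_re_two_pow_mul_le {g : ℝ → ℂ} (hg : IsCF g) (t : ℝ) (m : ℕ) :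
    1 - (g (2 ^ m * t)).re ≤ 4 ^ m * (1 - (g t).re) := by
  induction m with
  | zero => simp
  | succ m ih =>
    have := hg.one_sub_re_two_mul_le (2 ^ m * t)
    rw [← mul_assoc, ← pow_succ'] at this
    rw [pow_succ' (4 : ℝ)]
    linarith

/-! ### Continuous logarithms -/

/-- A continuous branch of a logarithm, vanishing somewhere, is small where its exponential is
close to `1`. -/
theorem norm_le_of_norm_exp_sub_one_le {S : Set ℝ} (hS : IsPreconnected S) {γ : ℝ → ℂ}
    (hγ : ContinuousOn γ S) {x : ℝ} (hx : x ∈ S) (hγx : γ x = 0)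
    (h : ∀ y ∈ S, ‖Complex.exp (γ y) - 1‖ ≤ 1 / 2) {y : ℝ} (hy : y ∈ S) :
    ‖γ y‖ ≤ 3 / 2 * ‖Complex.exp (γ y) - 1‖ := by
  -- Closeness to `1` keeps `cos (Im γ)` positive, so `Im γ`, which vanishes at `x`, cannot cross
  -- `±π/2` on the connected set `S`. Hence `γ` is the principal logarithm.
  have hcos : ∀ z ∈ S, 0 < Real.cos (γ z).im := by
    intro z hz
    have h1 := (Complex.abs_re_le_norm _).trans (h z hz)
    rw [Complex.sub_re, Complex.one_re, Complex.exp_re] at h1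
    have h2 := (abs_le.1 h1).1
    exact pos_of_mul_pos_right (by linarith) (Real.exp_pos _).le
  have hconn : (((fun z => (γ z).im) '' S)).OrdConnected :=
    (hS.image _ (Complex.continuous_im.comp_continuousOn hγ)).ordConnected
  have h0 : (0 : ℝ) ∈ (fun z => (γ z).im) '' S := ⟨x, hx, by simp [hγx]⟩
  have hpi := Real.pi_pos
  have hup : (γ y).im < Real.pi / 2 := by
    by_contra! hc
    obtain ⟨z, hz, hze⟩ := hconn.out h0 ⟨y, hy, rfl⟩ ⟨by positivity, hc⟩
    have := hcos z hz
    simp only at hze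
    simp [hze] at this
  have hlow : -(Real.pi / 2) < (γ y).im := by
    by_contra! hc
    obtain ⟨z, hz, hze⟩ := hconn.out ⟨y, hy, rfl⟩ h0 ⟨hc, by linarith⟩
    have := hcos z hz
    simp only at hze
    simp [hze] at this
  have hlog := Complex.log_exp (x := γ y) (by linarith) (by linarith)
  have hb := Complex.norm_log_one_add_half_le_self (z := Complex.exp (γ y) - 1) (h y hy)
  rwa [add_sub_cancel, hlog] at hb

theorem eq_zero_of_exp_eq_one {γ : ℝ → ℂ} (hγ : Continuous γ) (h0 : γ 0 = 0)
    (h : ∀ t, Complex.exp (γ t) = 1) (t : ℝ) : γ t = 0 := by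
  have := norm_le_of_norm_exp_sub_one_le isPreconnected_univ hγ.continuousOn (Set.mem_univ 0) h0
    (fun y _ => by simp [h]) (Set.mem_univ t)
  simpa [h] using this

/-! ### Compactness of the exponents -/

/-- **Arzelà–Ascoli** for sequences of functions on the line. -/
theorem exists_subseq_tendsto_of_equicontinuous {ψ : ℕ → ℝ → ℂ}
    (hb : ∀ t, ∃ M, ∀ k, ‖ψ k t‖ ≤ M)
    (he : ∀ x, ∀ ε > 0, ∃ δ > 0, ∀ k y, |y - x| < δ → ‖ψ k y - ψ k x‖ ≤ ε) :
    ∃ (ψ' : ℝ → ℂ) (σ : ℕ → ℕ), Continuous ψ' ∧ StrictMono σ ∧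
      ∀ t, Tendsto (fun k => ψ (σ k) t) atTop (𝓝 (ψ' t)) := by
  choose M hM using hb
  choose! δ hδ he using he
  -- Compact for pointwise convergence by Tychonoff, and made of continuous functions, so it is the
  -- image of a set in `C(ℝ, ℂ)`.
  let A : Set (ℝ → ℂ) := {F | (∀ t, F t ∈ Metric.closedBall 0 (M t)) ∧
    ∀ x, ∀ ε > 0, ∀ y, |y - x| < δ x ε → ‖F y - F x‖ ≤ ε}
  have hA : IsCompact A := by
    have h1 : IsCompact {F : ℝ → ℂ | ∀ t, F t ∈ Metric.closedBall 0 (M t)} :=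
      isCompact_pi_infinite fun t => isCompact_closedBall _ _
    have h2 : IsClosed {F : ℝ → ℂ | ∀ x, ∀ ε > 0, ∀ y, |y - x| < δ x ε → ‖F y - F x‖ ≤ ε} := by
      simp only [Set.ofPred_forall]
      refine isClosed_iInter fun x => isClosed_iInter fun ε => isClosed_iInter fun _ =>
        isClosed_iInter fun y => isClosed_iInter fun _ => ?_
      exact isClosed_le (by fun_prop) continuous_const
    exact h1.inter_right h2
  have hAc : ∀ F ∈ A, Continuous F := by
    intro F hF
    rw [Metric.continuous_iff]
    intro x ε hε
    refine ⟨δ x (ε / 2), hδ x _ (by positivity), fun y hy => ?_⟩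
    rw [dist_eq_norm]
    exact (hF.2 x (ε / 2) (by positivity) y hy).trans_lt (by linarith)
  let S : Set C(ℝ, ℂ) := {F | (F : ℝ → ℂ) ∈ A}
  have hSA : ContinuousMap.toFun '' S = A := by
    ext F
    constructor
    · rintro ⟨G, hG, rfl⟩
      exact hG
    · intro hF
      exact ⟨⟨F, hAc F hF⟩, hF, rfl⟩
  have hS : IsCompact S := by
    refine ArzelaAscoli.isCompact_of_equicontinuous S (hSA ▸ hA) ?_
    intro x
    rw [Metric.equicontinuousAt_iff]
    intro ε hε
    refine ⟨δ x (ε / 2), hδ x _ (by positivity), fun y hy F => ?_⟩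
    rw [dist_comm, dist_eq_norm]
    exact (F.2.2 x (ε / 2) (by positivity) y hy).trans_lt (by linarith)
  have hψA : ∀ k, ψ k ∈ A := fun k =>
    ⟨fun t => by simpa using hM t k, fun x ε hε y hy => he x ε hε k y hy⟩
  obtain ⟨F, -, σ, hσ, hlim⟩ := hS.tendsto_subseq
    (x := fun k => (⟨ψ k, hAc _ (hψA k)⟩ : C(ℝ, ℂ))) (fun k => hψA k)
  exact ⟨F, σ, F.continuous, hσ, fun t => ((continuous_eval_const (F := C(ℝ, ℂ)) t).tendsto F).comp hlim⟩

/-- Functions vanishing at `0` with a common modulus of continuity on `[-T, T]` are bounded there. -/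
theorem norm_le_of_uniform_modulus {T δ : ℝ} (hδ : 0 < δ) :
    ∃ M : ℝ, ∀ ψ : ℝ → ℂ, ψ 0 = 0 →
      (∀ x y, |x| ≤ T → |y - x| < δ → ‖ψ y - ψ x‖ ≤ 1) → ∀ t, |t| ≤ T → ‖ψ t‖ ≤ M := by
  -- `N + 1` equal steps from `0` to `t` are shorter than `δ`, stay in `[-T, T]` and cost at most
  -- `1` each.
  obtain ⟨N, hN⟩ := exists_nat_gt (T / δ)
  refine ⟨(N + 1 : ℕ), fun ψ h0 h t ht => ?_⟩
  have hN1 : (0 : ℝ) < (N + 1 : ℕ) := by positivity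
  have hstep : |t / (N + 1 : ℕ)| < δ := by
    rw [abs_div, abs_of_pos hN1, div_lt_iff₀ hN1]
    rw [div_lt_iff₀ hδ] at hN
    push_cast
    linarith
  have key : ∀ j : ℕ, j ≤ N + 1 → ‖ψ (j * (t / (N + 1 : ℕ)))‖ ≤ j := by
    intro j
    induction j with
    | zero => simp [h0]
    | succ j ih =>
      intro hj
      have hjN : (j : ℝ) ≤ (N + 1 : ℕ) := by exact_mod_cast (by omega : j ≤ N + 1)
      have h1 : |(j : ℝ) * (t / (N + 1 : ℕ))| ≤ T := by
        rw [mul_div_assoc', abs_div, abs_mul, abs_of_pos hN1, Nat.abs_cast, div_le_iff₀ hN1]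
        nlinarith [abs_nonneg t, mul_le_mul_of_nonneg_right hjN (abs_nonneg t),
          mul_le_mul_of_nonneg_left ht hN1.le]
      have h2 := h _ ((j + 1 : ℕ) * (t / (N + 1 : ℕ))) h1 (by
        have : ((j + 1 : ℕ) : ℝ) * (t / (N + 1 : ℕ)) - j * (t / (N + 1 : ℕ)) = t / (N + 1 : ℕ) := by
          push_cast; ring
        rwa [this])
      calc ‖ψ ((j + 1 : ℕ) * (t / (N + 1 : ℕ)))‖
          ≤ ‖ψ ((j + 1 : ℕ) * (t / (N + 1 : ℕ))) - ψ (j * (t / (N + 1 : ℕ)))‖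
            + ‖ψ (j * (t / (N + 1 : ℕ)))‖ := norm_le_norm_sub_add _ _
        _ ≤ 1 + j := add_le_add h2 (ih (by omega))
        _ = (j + 1 : ℕ) := by push_cast; ring
  have := key (N + 1) le_rfl
  rwa [mul_div_cancel₀ _ hN1.ne'] at this

/-- If the compound Poisson laws with exponents `u k * (c k * (1 - g k))` are tight, with `u k`
bounded away from `0` and `∞`, then the real parts of `c k * (1 - g k)` are locally bounded. -/
theorem exists_re_le_of_tight {g : ℕ → ℝ → ℂ} {c u : ℕ → ℝ} {u₀ : ℝ} (hg : ∀ k, IsCF (g k))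
    (hc : ∀ k, 0 ≤ c k) (hu₀ : 0 < u₀) (hu : ∀ k, u₀ ≤ u k)
    {P : ℕ → Measure ℝ} [∀ k, IsProbabilityMeasure (P k)]
    (hPt : IsTightMeasureSet (Set.range P))
    (hP : ∀ k t, charFun (P k) t = Complex.exp (-(u k * (c k * (1 - g k t))))) (T : ℝ) :
    ∃ M, 0 ≤ M ∧ ∀ k t, |t| ≤ T → c k * (1 - (g k t).re) ≤ M := by
  -- Near `0` the modulus stays at least `1/2 > exp (-1)`, which bounds the real part of the
  -- exponent by `1`.
  obtain ⟨δ, hδ, h⟩ := uniformEquicontinuous_charFun hPt (ε := 1 / 2) (by norm_num)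
  have hsmall : ∀ k t, |t| < δ → c k * (1 - (g k t).re) ≤ 1 / u₀ := by
    intro k t ht
    have h1 := h k t 0 (by simpa using ht)
    rw [charFun_zero] at h1
    simp only [probReal_univ, Complex.ofReal_one] at h1
    have h2 : 1 / 2 ≤ ‖charFun (P k) t‖ := by
      have := norm_sub_norm_le (1 : ℂ) (charFun (P k) t)
      rw [norm_sub_rev, norm_one] at this
      linarith
    have hre : (-(u k * (c k * (1 - g k t)) : ℂ)).re = -(u k * (c k * (1 - (g k t).re))) := by
      rw [← Complex.ofReal_one, ← mul_assoc, ← Complex.ofReal_mul, Complex.neg_re,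
        Complex.re_ofReal_mul, Complex.sub_re, Complex.ofReal_re, mul_assoc]
    rw [hP, Complex.norm_exp, hre] at h2
    have h3 : u k * (c k * (1 - (g k t).re)) ≤ 1 := by
      by_contra! hcon
      have h4 : Real.exp (-(u k * (c k * (1 - (g k t).re)))) < Real.exp (-1) :=
        Real.exp_lt_exp.2 (by linarith)
      have h5 := Real.exp_neg_one_lt_half
      linarith
    have h6 : 0 ≤ c k * (1 - (g k t).re) :=
      mul_nonneg (hc k) (by linarith [(hg k).re_le_one t])
    rw [le_div_iff₀ hu₀]
    nlinarith [hu k]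
  -- Halving `t` `m` times brings it within `δ`; doubling back costs `4 ^ m`.
  obtain ⟨m, hm⟩ := pow_unbounded_of_one_lt (T / δ) (one_lt_two (α := ℝ))
  refine ⟨4 ^ m * (1 / u₀), by positivity, fun k t ht => ?_⟩
  have h2m : (0 : ℝ) < 2 ^ m := by positivity
  have ht' : |t / 2 ^ m| < δ := by
    rw [abs_div, abs_of_pos h2m, div_lt_iff₀ h2m]
    rw [div_lt_iff₀ hδ] at hm
    linarith
  have h1 := (hg k).one_sub_re_two_pow_mul_le (t / 2 ^ m) m
  rw [mul_div_cancel₀ _ h2m.ne'] at h1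
  calc c k * (1 - (g k t).re) ≤ c k * (4 ^ m * (1 - (g k (t / 2 ^ m)).re)) :=
        mul_le_mul_of_nonneg_left h1 (hc k)
    _ = 4 ^ m * (c k * (1 - (g k (t / 2 ^ m)).re)) := by ring
    _ ≤ 4 ^ m * (1 / u₀) := by gcongr; exact hsmall k _ ht'

/-- On `[-T, T]` the characteristic functions are bounded away from `0`, so their equicontinuity
passes to quotients and, by the continuous logarithm, to the exponents. The bounds on `u k` allow it
to be divided out. -/
theorem exists_subseq_exponent_tendsto_of_tight {g : ℕ → ℝ → ℂ} {c u : ℕ → ℝ} {u₀ u₁ : ℝ}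
    (hg : ∀ k, IsCF (g k)) (hc : ∀ k, 0 ≤ c k) (hu₀ : 0 < u₀) (hu : ∀ k, u₀ ≤ u k)
    (hu' : ∀ k, u k ≤ u₁) {P : ℕ → Measure ℝ} [∀ k, IsProbabilityMeasure (P k)]
    (hPt : IsTightMeasureSet (Set.range P))
    (hP : ∀ k t, charFun (P k) t = Complex.exp (-(u k * (c k * (1 - g k t))))) :
    ∃ (ψ : ℝ → ℂ) (σ : ℕ → ℕ), Continuous ψ ∧ StrictMono σ ∧
      ∀ t, Tendsto (fun k => (c (σ k) : ℂ) * (1 - g (σ k) t)) atTop (𝓝 (ψ t)) := by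
  have hu1 : 0 < u₁ := hu₀.trans_le ((hu 0).trans (hu' 0))
  have hcont : ∀ k, Continuous (g k) := fun k => (hg k).continuous
  have hmod : ∀ T, ∀ ε > 0, ∃ δ > 0, ∀ k x y, |x| ≤ T → |y - x| < δ →
      ‖(c k : ℂ) * (1 - g k y) - c k * (1 - g k x)‖ ≤ ε := by
    intro T ε hε
    obtain ⟨M, hM0, hM⟩ := exists_re_le_of_tight hg hc hu₀ hu hPt hP T
    -- `1 / 2` is the range of the logarithm estimate; the other term absorbs its factor `3 / 2` and
    -- the division by `u k ≥ u₀`.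
    let η := min (1 / 2) (2 / 3 * (u₀ * ε))
    have hη : 0 < η := lt_min (by norm_num) (by positivity)
    obtain ⟨δ, hδ, h⟩ := uniformEquicontinuous_charFun hPt
      (ε := Real.exp (-(u₁ * M)) * η) (by positivity)
    refine ⟨δ, hδ, fun k x y hx hy => ?_⟩
    have huk := hu₀.trans_le (hu k)
    have hnorm : Real.exp (-(u₁ * M)) ≤ ‖charFun (P k) x‖ := by
      have hre : (-(u k * (c k * (1 - g k x)) : ℂ)).re = -(u k * (c k * (1 - (g k x).re))) := by
        rw [← Complex.ofReal_one, ← mul_assoc, ← Complex.ofReal_mul, Complex.neg_re,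
          Complex.re_ofReal_mul, Complex.sub_re, Complex.ofReal_re, mul_assoc]
      rw [hP, Complex.norm_exp, hre, Real.exp_le_exp, neg_le_neg_iff]
      exact mul_le_mul (hu' k) (hM k x hx)
        (mul_nonneg (hc k) (by linarith [(hg k).re_le_one x])) hu1.le
    -- A continuous logarithm of the quotient of the values at `z` and `x`, vanishing at `x`.
    let γ : ℝ → ℂ := fun z => -(u k * (c k * (1 - g k z) - c k * (1 - g k x)))
    have hγe : ∀ z ∈ Metric.ball x δ, ‖Complex.exp (γ z) - 1‖ ≤ η := by
      intro z hz
      have e : charFun (P k) x * (Complex.exp (γ z) - 1) = charFun (P k) z - charFun (P k) x := by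
        rw [hP, hP, mul_sub, ← Complex.exp_add, mul_one]
        congr 2
        simp only [γ]
        ring
      have h1 := h k z x hz
      rw [← e, norm_mul] at h1
      have h2 := (mul_le_mul_of_nonneg_right hnorm (norm_nonneg (Complex.exp (γ z) - 1))).trans h1
      exact le_of_mul_le_mul_left h2 (Real.exp_pos _)
    have hyb : y ∈ Metric.ball x δ := hy
    have h3 := norm_le_of_norm_exp_sub_one_le (convex_ball x δ).isPreconnected (γ := γ)
      (by have := hcont k; fun_prop) (Metric.mem_ball_self hδ) (by simp [γ])
      (fun z hz => (hγe z hz).trans (min_le_left _ _)) hyb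
    have h4 : ‖γ y‖ ≤ u₀ * ε := by
      have := (hγe y hyb).trans (min_le_right _ _)
      linarith
    have h5 : ‖γ y‖ = u k * ‖(c k : ℂ) * (1 - g k y) - c k * (1 - g k x)‖ := by
      simp only [γ]
      rw [norm_neg, norm_mul, Complex.norm_real, Real.norm_of_nonneg huk.le]
    rw [h5] at h4
    exact le_of_mul_le_mul_left
      ((mul_le_mul_of_nonneg_right (hu k) (norm_nonneg _)).trans h4) hu₀
  apply exists_subseq_tendsto_of_equicontinuous (ψ := fun k t => (c k : ℂ) * (1 - g k t))
  · intro t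
    obtain ⟨δ, hδ, h⟩ := hmod |t| 1 one_pos
    obtain ⟨M, hM⟩ := norm_le_of_uniform_modulus (T := |t|) hδ
    exact ⟨M, fun k => hM _ (by simp [(hg k).apply_zero]) (fun x y => h k x y) t le_rfl⟩
  · intro x ε hε
    obtain ⟨δ, hδ, h⟩ := hmod |x| ε hε
    exact ⟨δ, hδ, fun k y => h k x y le_rfl⟩

/-- Each `exp (-r ψ)`, `r ≥ 0`, is a limit of compound Poisson characteristic functions of intensity
`r c k`; `r = 1 / n` supplies the `n`-th root. -/
theorem isIDExponent_of_tendsto {g : ℕ → ℝ → ℂ} {c : ℕ → ℝ} (hg : ∀ k, IsCF (g k))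
    (hc : ∀ k, 0 ≤ c k) {ψ : ℝ → ℂ} (hψ : Continuous ψ)
    (hlim : ∀ t, Tendsto (fun k => (c k : ℂ) * (1 - g k t)) atTop (𝓝 (ψ t))) :
    IsIDExponent ψ := by
  have key : ∀ r : ℝ, 0 ≤ r → IsCF fun t => Complex.exp (-(r * ψ t)) := by
    intro r hr
    refine isCF_of_tendsto (h := fun k t => Complex.exp (-((r * c k : ℝ) * (1 - g k t))))
      (fun k => (hg k).compoundPoisson (mul_nonneg hr (hc k))) (by fun_prop) fun t => ?_
    have : Continuous fun z : ℂ => Complex.exp (-(r * z)) := by fun_prop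
    refine ((this.tendsto _).comp (hlim t)).congr fun k => ?_
    simp [mul_assoc]
  refine ⟨hψ, ?_, by simpa using key 1 zero_le_one, fun n hn =>
    ⟨_, key (1 / n) (by positivity), fun t => ?_⟩⟩
  · refine tendsto_nhds_unique (hlim 0) ?_
    simp [(hg _).apply_zero]
  · rw [← Complex.exp_nat_mul]
    have : (n : ℂ) ≠ 0 := by exact_mod_cast (by omega : n ≠ 0)
    push_cast
    field_simp

/-! ### Tail bounds for mixtures -/

/-- The bound on the tail `P {|x| > r}` given by the mean of `1 - Re h` over `[-2 / r, 2 / r]`. -/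
def tailBound (h : ℝ → ℂ) (r : ℝ) : ℝ :=
  2⁻¹ * r * ∫ t in (-(2 * r⁻¹))..(2 * r⁻¹), (1 - (h t).re)

/-- The usual estimate has the norm of the integral of `1 - charFun P`. By symmetry of the interval
that integral is real, which yields a bound affine in the characteristic function that can be
averaged over `U`. -/
theorem measureReal_abs_gt_le_tailBound {P : Measure ℝ} [IsProbabilityMeasure P] {r : ℝ}
    (hr : 0 < r) : P.real {x | r < |x|} ≤ tailBound (charFun P) r := by
  have ha : 0 < 2 * r⁻¹ := by positivity
  have hint : IntervalIntegrable (fun t => 1 - charFun P t) volume (-(2 * r⁻¹)) (2 * r⁻¹) :=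
    intervalIntegrable_const.sub intervalIntegrable_charFun
  have hre : ∫ t in (-(2 * r⁻¹))..(2 * r⁻¹), (1 - (charFun P t).re) =
      (∫ t in (-(2 * r⁻¹))..(2 * r⁻¹), (1 - charFun P t)).re := by
    have := Complex.reCLM.intervalIntegral_comp_comm hint
    simpa using this
  have him : (∫ t in (-(2 * r⁻¹))..(2 * r⁻¹), (1 - charFun P t)).im = 0 := by
    rw [intervalIntegral.integral_sub intervalIntegrable_const intervalIntegrable_charFun,
      integral_charFun_Icc ha]
    simp [-Complex.ofReal_mul, ← Complex.ofReal_ofNat, -Complex.ofReal_inv,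
      ← Complex.ofReal_mul]
  have h := measureReal_abs_gt_le_integral_charFun (μ := P) hr
  rw [neg_mul] at h
  refine h.trans_eq ?_
  rw [tailBound, hre, ← abs_of_nonneg (a := Complex.re _), Complex.abs_re_eq_norm.2 him]
  rw [← hre]
  refine intervalIntegral.integral_nonneg (by linarith) fun t _ => ?_
  linarith [(Complex.re_le_norm _).trans (norm_charFun_le_one (μ := P) t)]

theorem tendsto_laplace {μ : Measure ℝ≥0} [IsProbabilityMeasure μ] {z : ℕ → ℂ} {w : ℂ}
    (hz : ∀ k, 0 ≤ (z k).re) (h : Tendsto z atTop (𝓝 w)) :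
    Tendsto (fun k => laplace μ (z k)) atTop (𝓝 (laplace μ w)) := by
  refine tendsto_integral_of_dominated_convergence (fun _ => 1) (fun k => by fun_prop)
    (integrable_const _) (fun k => ae_of_all _ fun u => ?_) (ae_of_all _ fun u => ?_)
  · rw [Complex.norm_exp, Complex.neg_re, Complex.re_mul_ofReal]
    exact Real.exp_le_one_iff.2 (neg_nonpos.2 (mul_nonneg (hz k) u.2))
  · have : Continuous fun z : ℂ => Complex.exp (-(z * ((u : ℝ) : ℂ))) := by fun_prop
    exact (this.tendsto w).comp h

theorem norm_laplace_le_one {μ : Measure ℝ≥0} [IsProbabilityMeasure μ] {z : ℂ} (hz : 0 ≤ z.re) :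
    ‖laplace μ z‖ ≤ 1 := by
  refine (norm_integral_le_of_norm_le_const (C := 1) (ae_of_all _ fun u => ?_)).trans (by simp)
  rw [Complex.norm_exp, Complex.neg_re, Complex.re_mul_ofReal]
  exact Real.exp_le_one_iff.2 (neg_nonpos.2 (mul_nonneg hz u.2))

theorem continuous_laplace_comp {μ : Measure ℝ≥0} [IsProbabilityMeasure μ] {ψ : ℝ → ℂ}
    (hψ : Continuous ψ) (hre : ∀ t, 0 ≤ (ψ t).re) : Continuous fun t => laplace μ (ψ t) :=
  continuous_iff_seqContinuous.2 fun x a hx =>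
    tendsto_laplace (fun k => hre (x k)) ((hψ.tendsto a).comp hx)

theorem integrable_tailBound_integrand (μ : Measure ℝ≥0) [IsProbabilityMeasure μ] {ψ : ℝ → ℂ}
    (hψ : Continuous ψ) (hre : ∀ t, 0 ≤ (ψ t).re) (a b : ℝ) :
    Integrable (Function.uncurry fun (t : ℝ) (u : ℝ≥0) =>
      1 - (Complex.exp (-(ψ t * ((u : ℝ) : ℂ)))).re) ((volume.restrict (Set.uIoc a b)).prod μ) := by
  have hfin : IsFiniteMeasure (volume.restrict (Set.uIoc a b)) := by
    rw [Set.uIoc]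
    infer_instance
  refine Integrable.of_bound (C := 2) ?_ (ae_of_all _ fun p => ?_)
  · refine Continuous.aestronglyMeasurable ?_
    unfold Function.uncurry
    fun_prop
  · have h1 : ‖Complex.exp (-(ψ p.1 * ((p.2 : ℝ) : ℂ)))‖ ≤ 1 := by
      rw [Complex.norm_exp, Complex.neg_re, Complex.re_mul_ofReal]
      exact Real.exp_le_one_iff.2 (neg_nonpos.2 (mul_nonneg (hre _) p.2.2))
    have h2 := abs_le.1 ((Complex.abs_re_le_norm _).trans h1)
    rw [Function.uncurry, Real.norm_eq_abs, abs_le]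
    constructor <;> linarith [h2.1, h2.2]

theorem integrable_tailBound (μ : Measure ℝ≥0) [IsProbabilityMeasure μ] {ψ : ℝ → ℂ}
    (hψ : Continuous ψ) (hre : ∀ t, 0 ≤ (ψ t).re) {r : ℝ} (hr : 0 < r) :
    Integrable (fun u : ℝ≥0 => tailBound (fun t => Complex.exp (-(ψ t * ((u : ℝ) : ℂ)))) r) μ := by
  have ha : 0 < 2 * r⁻¹ := by positivity
  have h := integrable_tailBound_integrand μ hψ hre (-(2 * r⁻¹)) (2 * r⁻¹)
  rw [Set.uIoc_of_le (by linarith)] at h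
  have h' := (h.integral_prod_right).const_mul (2⁻¹ * r)
  refine h'.congr (ae_of_all _ fun u => ?_)
  simp only [tailBound, intervalIntegral.integral_of_le (by linarith : -(2 * r⁻¹) ≤ 2 * r⁻¹),
    Function.uncurry]

/-- Fubini: smallness for the mixture becomes smallness in mean for its components. -/
theorem integral_tailBound (μ : Measure ℝ≥0) [IsProbabilityMeasure μ] {ψ : ℝ → ℂ}
    (hψ : Continuous ψ) (hre : ∀ t, 0 ≤ (ψ t).re) (r : ℝ) :
    ∫ u : ℝ≥0, tailBound (fun t => Complex.exp (-(ψ t * ((u : ℝ) : ℂ)))) r ∂μ =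
      tailBound (fun t => laplace μ (ψ t)) r := by
  simp only [tailBound]
  rw [integral_const_mul, ← intervalIntegral_integral_swap
    (integrable_tailBound_integrand μ hψ hre _ _)]
  congr 1
  refine intervalIntegral.integral_congr fun t _ => ?_
  have hint : Integrable (fun u : ℝ≥0 => Complex.exp (-(ψ t * ((u : ℝ) : ℂ)))) μ := by
    refine Integrable.of_bound (C := 1) (by fun_prop) (ae_of_all _ fun u => ?_)
    rw [Complex.norm_exp, Complex.neg_re, Complex.re_mul_ofReal]
    exact Real.exp_le_one_iff.2 (neg_nonpos.2 (mul_nonneg (hre t) u.2))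
  have hr := integral_re (𝕜 := ℂ) hint
  simp only [RCLike.re_eq_complex_re] at hr
  have hri := hint.re
  simp only [RCLike.re_eq_complex_re] at hri
  rw [integral_sub (integrable_const _) hri, hr, laplace]
  simp

theorem tailBound_nonneg {h : ℝ → ℂ} (hh : ∀ t, ‖h t‖ ≤ 1) {r : ℝ} (hr : 0 < r) :
    0 ≤ tailBound h r := by
  have ha : 0 < 2 * r⁻¹ := by positivity
  refine mul_nonneg (by positivity) (intervalIntegral.integral_nonneg (by linarith) fun t _ => ?_)
  linarith [(Complex.re_le_norm _).trans (hh t)]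

/-- Continuity of `f` at `0` makes its tail bound small for large `r`, and dominated convergence
passes this to `F k`. -/
theorem eventually_tailBound_le {f : ℝ → ℂ} {F : ℕ → ℝ → ℂ} (hF : ∀ k t, ‖F k t‖ ≤ 1)
    (hFm : ∀ k, Continuous (F k)) (hf : IsCF f)
    (hlim : ∀ t, Tendsto (fun k => F k t) atTop (𝓝 (f t))) {ε : ℝ} (hε : 0 < ε) :
    ∃ r > 0, ∀ᶠ k in atTop, tailBound (F k) r ≤ ε := by
  obtain ⟨δ, hδ, h⟩ := Metric.continuousAt_iff.1 (hf.continuous.continuousAt (x := 0)) (ε / 4)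
    (by positivity)
  have hfc := hf.continuous
  -- With this `r` the interval is `[-δ/2, δ/2]`, and an integrand at most `ε / 4` gives `ε / 2`.
  have hr : 0 < 4 / δ := by positivity
  have ha : 0 < 2 * (4 / δ)⁻¹ := by positivity
  have haδ : 2 * (4 / δ)⁻¹ < δ := by
    rw [inv_div]
    linarith
  refine ⟨4 / δ, hr, ?_⟩
  have hfr : tailBound f (4 / δ) ≤ ε / 2 := by
    have : ∫ t in (-(2 * (4 / δ)⁻¹))..(2 * (4 / δ)⁻¹), (1 - (f t).re) ≤
        ∫ t in (-(2 * (4 / δ)⁻¹))..(2 * (4 / δ)⁻¹), ε / 4 := by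
      refine intervalIntegral.integral_mono_on (by linarith)
        (Continuous.intervalIntegrable (by fun_prop) _ _) intervalIntegrable_const fun t ht => ?_
      have h1 : dist t 0 < δ := by
        rw [Real.dist_eq, sub_zero, abs_lt]
        constructor <;> linarith [ht.1, ht.2]
      have h2 := h h1
      rw [hf.apply_zero, dist_comm, dist_eq_norm] at h2
      have h3 := (Complex.re_le_norm _).trans h2.le
      simpa using h3
    calc tailBound f (4 / δ) ≤ 2⁻¹ * (4 / δ) *
        ∫ t in (-(2 * (4 / δ)⁻¹))..(2 * (4 / δ)⁻¹), ε / 4 := by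
          unfold tailBound
          gcongr
      _ = ε / 2 := by
        rw [intervalIntegral.integral_const, smul_eq_mul]
        field_simp
        ring
  have ht : Tendsto (fun k => tailBound (F k) (4 / δ)) atTop (𝓝 (tailBound f (4 / δ))) := by
    refine Tendsto.const_mul _ ?_
    refine intervalIntegral.tendsto_integral_filter_of_dominated_convergence (fun _ => 2)
      (Eventually.of_forall fun k => ?_) (Eventually.of_forall fun k => ae_of_all _ fun t _ => ?_)
      intervalIntegrable_const (ae_of_all _ fun t _ => ?_)
    · have := hFm k
      exact Continuous.aestronglyMeasurable (by fun_prop)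
    · have := abs_le.1 ((Complex.abs_re_le_norm _).trans (hF k t))
      rw [Real.norm_eq_abs, abs_le]
      constructor <;> linarith [this.1, this.2]
    · exact tendsto_const_nhds.sub ((Complex.continuous_re.tendsto _).comp (hlim t))
  filter_upwards [ht.eventually_lt_const (hfr.trans_lt (by linarith : ε / 2 < ε))] with k hk
  exact hk.le

/-! ### Selection of tight times -/

/-- Functions with geometrically small means are simultaneously geometrically small somewhere. -/
theorem exists_mem_forall_le_of_lintegral_le {α : Type*} [MeasurableSpace α] {μ : Measure α}
    [IsFiniteMeasure μ] {s : Set α} (hs : μ s ≠ 0) {a : ℕ → α → ENNReal}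
    (ha : ∀ j, AEMeasurable (a j) μ) (h : ∀ j, ∫⁻ x, a j x ∂μ ≤ 4⁻¹ ^ j) :
    ∃ x ∈ s, ∀ j, a j x ≤ 2 * (μ s)⁻¹ * 2⁻¹ ^ j := by
  -- The weighted sum has integral at most `∑ 2⁻ʲ = 2`, and some point of `s` lies below its average
  -- over `s`.
  have hm : AEMeasurable (fun x => ∑' j, 2 ^ j * a j x) μ :=
    AEMeasurable.tsum fun j => (ha j).const_mul _
  obtain ⟨x, hx, hle⟩ := exists_le_setLAverage hs (measure_ne_top μ s) hm.restrict
  refine ⟨x, hx, fun j => ?_⟩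
  have h42 : (2 : ENNReal) * 4⁻¹ = 2⁻¹ := by
    rw [show (4 : ENNReal) = 2 * 2 by norm_num, ENNReal.mul_inv (by simp) (by simp), ← mul_assoc,
      ENNReal.mul_inv_cancel (by simp) (by simp), one_mul]
  have hint : ∫⁻ x in s, ∑' j, 2 ^ j * a j x ∂μ ≤ 2 := by
    refine (lintegral_mono' Measure.restrict_le_self le_rfl).trans ?_
    rw [lintegral_tsum fun j => (ha j).const_mul _]
    calc ∑' j, ∫⁻ x, 2 ^ j * a j x ∂μ ≤ ∑' j, (2⁻¹ : ENNReal) ^ j := by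
          refine ENNReal.tsum_le_tsum fun j => ?_
          rw [lintegral_const_mul'' _ (ha j)]
          calc (2 : ENNReal) ^ j * ∫⁻ x, a j x ∂μ ≤ 2 ^ j * 4⁻¹ ^ j := by gcongr; exact h j
            _ = 2⁻¹ ^ j := by rw [← mul_pow, h42]
      _ = 2 := by rw [ENNReal.tsum_geometric, ENNReal.one_sub_inv_two, inv_inv]
  have h1 : 2 ^ j * a j x ≤ 2 * (μ s)⁻¹ := by
    refine (ENNReal.le_tsum (f := fun j => 2 ^ j * a j x) j).trans (hle.trans ?_)
    rw [setLAverage_eq, div_eq_mul_inv]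
    gcongr
  calc a j x = 2⁻¹ ^ j * (2 ^ j * a j x) := by
        rw [← mul_assoc, ← mul_pow, ENNReal.inv_mul_cancel (by simp) (by simp), one_pow, one_mul]
    _ ≤ 2⁻¹ ^ j * (2 * (μ s)⁻¹) := by gcongr
    _ = _ := mul_comm _ _

/-- The intervals `[1/(n+1), n+1]` cover the complement of `0`, so they cannot all be null. -/
theorem exists_measure_Icc_ne_zero {μ : Measure ℝ≥0} (hμ : μ {0}ᶜ ≠ 0) :
    ∃ u₀ u₁ : ℝ≥0, 0 < u₀ ∧ μ (Set.Icc u₀ u₁) ≠ 0 := by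
  by_contra! hcon
  refine hμ (measure_mono_null (t := ⋃ n : ℕ, Set.Icc ((n + 1 : ℝ≥0)⁻¹) (n + 1)) ?_
    (measure_iUnion_null fun n => hcon _ _ (by positivity)))
  intro u hu
  have hu0 : 0 < u := pos_iff_ne_zero.2 hu
  obtain ⟨n, hn⟩ := exists_nat_ge (max u u⁻¹)
  refine Set.mem_iUnion.2 ⟨n, ?_, ?_⟩
  · rw [inv_le_comm₀ (by positivity) hu0]
    exact (le_max_right _ _).trans (hn.trans (by simp))
  · exact (le_max_left _ _).trans (hn.trans (by simp))

/-- If the mixtures `φ (c k * (1 - g k))` converge to a characteristic function and the mixing law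
is not concentrated at `0`, then the mixed compound Poisson laws are tight at suitable times. -/
theorem exists_tight_of_tendsto_laplace {μ : Measure ℝ≥0} [IsProbabilityMeasure μ]
    (hμ : μ {0}ᶜ ≠ 0) {g : ℕ → ℝ → ℂ} {c : ℕ → ℝ} (hg : ∀ k, IsCF (g k)) (hc : ∀ k, 0 ≤ c k)
    {f : ℝ → ℂ} (hf : IsCF f)
    (hlim : ∀ t, Tendsto (fun k => laplace μ (c k * (1 - g k t))) atTop (𝓝 (f t))) :
    ∃ (u₀ u₁ : ℝ) (u : ℕ → ℝ) (P : ℕ → Measure ℝ), 0 < u₀ ∧ (∀ k, u₀ ≤ u k) ∧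
      (∀ k, u k ≤ u₁) ∧ (∀ k, IsProbabilityMeasure (P k)) ∧
      IsTightMeasureSet (Set.range P) ∧
      ∀ k t, charFun (P k) t = Complex.exp (-(u k * (c k * (1 - g k t)))) := by
  obtain ⟨u₀, u₁, hu₀, hs⟩ := exists_measure_Icc_ne_zero hμ
  have hcont : ∀ k, Continuous fun t => (c k : ℂ) * (1 - g k t) := fun k => by
    have := (hg k).continuous
    fun_prop
  have hre : ∀ k t, 0 ≤ ((c k : ℂ) * (1 - g k t)).re := fun k t => by
    rw [Complex.re_ofReal_mul, Complex.sub_re, Complex.one_re]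
    exact mul_nonneg (hc k) (by linarith [(hg k).re_le_one t])
  have hr : ∀ j : ℕ, ∃ r > 0, ∀ᶠ k in atTop,
      tailBound (fun t => laplace μ (c k * (1 - g k t))) r ≤ 4⁻¹ ^ j := fun j =>
    eventually_tailBound_le (fun k t => norm_laplace_le_one (hre k t))
      (fun k => continuous_laplace_comp (hcont k) (hre k)) hf hlim (by positivity)
  choose r hr0 hr using hr
  -- The mixture bound at level `j` holds only for large `k`. Replacing the function by `0` where it
  -- fails makes the mean bound valid for all `k` and `j`, so one `u k` serves every level.
  let a : ℕ → ℕ → ℝ≥0 → ENNReal := fun k j u =>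
    if tailBound (fun t => laplace μ (c k * (1 - g k t))) (r j) ≤ 4⁻¹ ^ j then
      ENNReal.ofReal
        (tailBound (fun t => Complex.exp (-(c k * (1 - g k t) * ((u : ℝ) : ℂ)))) (r j))
    else 0
  have hcp : ∀ k (u : ℝ≥0), IsCF fun t => Complex.exp (-(c k * (1 - g k t) * ((u : ℝ) : ℂ))) := by
    intro k u
    have := (hg k).compoundPoisson (mul_nonneg u.coe_nonneg (hc k))
    convert this using 3
    push_cast
    ring
  have hsel : ∀ k, ∃ u ∈ Set.Icc u₀ u₁, ∀ j, a k j u ≤ 2 * (μ (Set.Icc u₀ u₁))⁻¹ * 2⁻¹ ^ j := by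
    intro k
    have hint := fun j => integrable_tailBound μ (hcont k) (hre k) (hr0 j)
    refine exists_mem_forall_le_of_lintegral_le hs (fun j => ?_) fun j => ?_
    · by_cases hk : tailBound (fun t => laplace μ (c k * (1 - g k t))) (r j) ≤ 4⁻¹ ^ j
      · simp only [a, hk, if_true]
        exact (hint j).aestronglyMeasurable.aemeasurable.ennreal_ofReal
      · simp only [a, hk, if_false]
        simp
    · by_cases hk : tailBound (fun t => laplace μ (c k * (1 - g k t))) (r j) ≤ 4⁻¹ ^ j
      · simp only [a, hk, if_true]
        rw [← ofReal_integral_eq_lintegral_ofReal (hint j) (ae_of_all _ fun u =>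
          tailBound_nonneg (hcp k u).norm_le_one (hr0 j)), integral_tailBound μ (hcont k) (hre k)]
        refine (ENNReal.ofReal_le_ofReal hk).trans_eq ?_
        rw [ENNReal.ofReal_pow (by norm_num), ENNReal.ofReal_inv_of_pos (by norm_num)]
        norm_num
      · simp only [a, hk, if_false]
        simp
  choose u hu hau using hsel
  choose P hP hPc using fun k => hcp k (u k)
  refine ⟨u₀, u₁, fun k => u k, P, hu₀, fun k => (hu k).1, fun k => (hu k).2, hP, ?_, fun k t => ?_⟩
  · refine isTightMeasureSet_range_of_tendsto_limsup_measure_norm_gt ?_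
    rw [ENNReal.tendsto_atTop_zero]
    intro ε hε
    have htend : Tendsto (fun j : ℕ => 2 * (μ (Set.Icc u₀ u₁))⁻¹ * (2⁻¹ : ENNReal) ^ j) atTop
        (𝓝 0) := by
      have h1 := ENNReal.tendsto_pow_atTop_nhds_zero_of_lt_one (r := (2⁻¹ : ENNReal)) (by simp)
      have h2 := ENNReal.Tendsto.const_mul (a := 2 * (μ (Set.Icc u₀ u₁))⁻¹) h1
        (Or.inr (ENNReal.mul_ne_top (by simp) (ENNReal.inv_ne_top.2 hs)))
      simpa using h2
    obtain ⟨j, hj⟩ := (htend.eventually (ge_mem_nhds hε)).exists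
    -- The limsup sees only large `k`, where the cutoff at level `j` is inactive.
    refine ⟨r j, fun R hR => limsup_le_of_le (by isBoundedDefault) ?_⟩
    filter_upwards [hr j] with k hk
    have h1 := hau k j
    simp only [a, hk, if_true] at h1
    have h2 : (fun t => Complex.exp (-(c k * (1 - g k t) * ((u k : ℝ) : ℂ)))) = charFun (P k) :=
      funext (hPc k)
    rw [h2] at h1
    calc P k {x | R < ‖x‖} ≤ P k {x | r j < |x|} :=
          measure_mono fun x hx => lt_of_le_of_lt hR hx
      _ = ENNReal.ofReal ((P k).real {x | r j < |x|}) := (ofReal_measureReal).symm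
      _ ≤ _ := ENNReal.ofReal_le_ofReal (measureReal_abs_gt_le_tailBound (hr0 j))
      _ ≤ _ := h1.trans hj
  · rw [← hPc k t]
    ring_nf

/-! ### The degenerate mixing law and the two inclusions -/

theorem laplace_eq_one {μ : Measure ℝ≥0} [IsProbabilityMeasure μ] (hμ : μ {0}ᶜ = 0) (z : ℂ) :
    laplace μ z = 1 := by
  have h : (fun u : ℝ≥0 => Complex.exp (-(z * ((u : ℝ) : ℂ)))) =ᵐ[μ] fun _ => 1 := by
    filter_upwards [compl_mem_ae_iff.2 hμ] with u hu
    have : u = 0 := by simpa using hu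
    simp [this]
  rw [laplace, integral_congr_ae h]
  simp

/-- Under sufficiently strong normalization every law is attracted to the point mass at `0`. -/
theorem IsCF.mem_DPA_one {g : ℝ → ℂ} (hg : IsCF g) : g ∈ DPA fun _ => 1 := by
  -- With `n_k = k + 1`, choose `a_k` so large that the exponent is at most `1 / (k + 1)` in norm on
  -- `[-k, k]`.
  have hex : ∀ k : ℕ, ∃ a : ℝ, 0 < a ∧ ∀ t : ℝ, |t| ≤ k → ((k + 1 : ℕ) : ℝ) * ‖1 - g (t / a)‖ ≤
      1 / ((k : ℝ) + 1) := by
    intro k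
    have hk : (0 : ℝ) < ((k + 1 : ℕ) : ℝ) := by positivity
    obtain ⟨δ, hδ, h⟩ := Metric.continuousAt_iff.1 (hg.continuous.continuousAt (x := 0))
      (1 / ((k : ℝ) + 1) / (k + 1 : ℕ)) (by positivity)
    refine ⟨(k + 1) / δ, by positivity, fun t ht => ?_⟩
    have h1 : dist (t / ((k + 1) / δ)) 0 < δ := by
      rw [Real.dist_eq, sub_zero, abs_div, abs_of_pos (by positivity : 0 < ((k : ℝ) + 1) / δ),
        div_lt_iff₀ (by positivity), mul_div_cancel₀ _ hδ.ne']
      linarith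
    have h2 := h h1
    rw [hg.apply_zero, dist_comm, dist_eq_norm, lt_div_iff₀ hk] at h2
    rw [mul_comm]
    exact h2.le
  choose a ha h using hex
  refine ⟨hg, fun k => k + 1, a, fun _ => 0, fun k => k.succ_pos, tendsto_add_atTop_nat 1, ha,
    fun t => ?_⟩
  have h0 : Tendsto (fun k : ℕ => ((k + 1 : ℕ) : ℂ) * (1 - PhiAttraction.normed g (a k) 0 t)) atTop
      (𝓝 0) := by
    rw [tendsto_zero_iff_norm_tendsto_zero]
    refine squeeze_zero' (Eventually.of_forall fun k => norm_nonneg _) ?_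
      tendsto_one_div_add_atTop_nhds_zero_nat
    obtain ⟨K, hK⟩ := exists_nat_ge |t|
    filter_upwards [eventually_ge_atTop K] with k hk
    rw [norm_mul, Complex.norm_natCast]
    have : (K : ℝ) ≤ k := by exact_mod_cast hk
    simpa [PhiAttraction.normed] using h k t (hK.trans this)
  have hc : Continuous fun z : ℂ => Complex.exp (-z) := by fun_prop
  simpa [Function.comp_def] using (hc.tendsto 0).comp h0

theorem isIDExponent_zero : IsIDExponent fun _ => 0 :=
  isIDExponent_of_tendsto (g := fun _ _ => 1) (c := fun _ => 0) (fun _ => isCF_one)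
    (fun _ => le_rfl) continuous_const fun _ => by simp

theorem DPPhiA_subset {μ : Measure ℝ≥0} [IsProbabilityMeasure μ] {f : ℝ → ℂ} (hf : IsCF f) :
    DPPhiA μ f ⊆ ⋃ ψ ∈ {ψ : ℝ → ℂ | Represents μ ψ f}, DPA (fun t => Complex.exp (-ψ t)) := by
  rintro g ⟨hg, n, a, b, hn, hnt, ha, hlim⟩
  simp only [Set.mem_iUnion, Set.mem_ofPred_eq]
  by_cases hμ : μ {0}ᶜ = 0
  · refine ⟨fun _ => 0, ⟨isIDExponent_zero, fun t => ?_⟩, by simpa using hg.mem_DPA_one⟩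
    refine tendsto_nhds_unique (hlim t) ?_
    simp [laplace_eq_one hμ]
  · have hgk : ∀ k, IsCF (normed g (a k) (b k)) := fun k => hg.normed _ _
    have hck : ∀ k, (0 : ℝ) ≤ (n k : ℝ) := fun k => Nat.cast_nonneg _
    obtain ⟨u₀, u₁, u, P, hu₀, hu, hu', hP, hPt, hPc⟩ :=
      exists_tight_of_tendsto_laplace (c := fun k => (n k : ℝ)) hμ hgk hck hf
        (by simpa using hlim)
    obtain ⟨ψ, σ, hψ, hσ, hψlim⟩ :=
      exists_subseq_exponent_tendsto_of_tight hgk hck hu₀ hu hu' hPt hPc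
    refine ⟨ψ, ⟨isIDExponent_of_tendsto (fun k => hgk (σ k)) (fun k => hck (σ k)) hψ hψlim,
      fun t => ?_⟩, hg, n ∘ σ, a ∘ σ, b ∘ σ, fun k => hn _, hnt.comp hσ.tendsto_atTop,
      fun k => ha _, fun t => ?_⟩
    · refine tendsto_nhds_unique ((hlim t).comp hσ.tendsto_atTop) ?_
      have := tendsto_laplace (μ := μ) (fun k => ?_) (hψlim t)
      · simpa [Function.comp_def] using this
      · rw [Complex.re_ofReal_mul, Complex.sub_re, Complex.one_re]
        exact mul_nonneg (hck _) (by linarith [(hgk (σ k)).re_le_one t])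
    · have hc : Continuous fun z : ℂ => Complex.exp (-z) := by fun_prop
      simpa [Function.comp_def] using (hc.tendsto _).comp (hψlim t)

/-- Convergence of compound Poisson characteristic functions to `exp (-ψ)` implies convergence of
the exponents. -/
theorem tendsto_exponent_of_tendsto_exp {g : ℕ → ℝ → ℂ} {c : ℕ → ℝ} (hg : ∀ k, IsCF (g k))
    (hc : ∀ k, 0 ≤ c k) {ψ : ℝ → ℂ} (hψ : Continuous ψ) (hψ0 : ψ 0 = 0)
    (hlim : ∀ t, Tendsto (fun k => Complex.exp (-(c k * (1 - g k t)))) atTop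
      (𝓝 (Complex.exp (-ψ t)))) (t : ℝ) :
    Tendsto (fun k => (c k : ℂ) * (1 - g k t)) atTop (𝓝 (ψ t)) := by
  choose P hP hPc using fun k => (hg k).compoundPoisson (hc k)
  have hPt : IsTightMeasureSet (Set.range P) := by
    refine isTightMeasureSet_of_tendsto_charFun (f := fun t => Complex.exp (-ψ t))
      (Continuous.continuousAt (by fun_prop)) fun t => ?_
    simpa only [← hPc] using hlim t
  -- Every subsequence has a further one converging to some continuous `ψ'` with `exp (-ψ') = exp
  -- (-ψ)`; both vanish at `0`, so `ψ' = ψ`.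
  refine tendsto_of_subseq_tendsto fun ns hns => ?_
  obtain ⟨ψ', σ, hψ', hσ, hψlim⟩ := exists_subseq_exponent_tendsto_of_tight
    (g := fun k => g (ns k)) (c := fun k => c (ns k)) (u := fun _ => 1) (u₀ := 1) (u₁ := 1)
    (P := fun k => P (ns k)) (fun k => hg _) (fun k => hc _) one_pos (fun _ => le_rfl)
    (fun _ => le_rfl) (hPt.subset (by rintro _ ⟨k, rfl⟩; exact ⟨ns k, rfl⟩))
    (fun k t => by rw [← hPc]; simp)
  refine ⟨σ, ?_⟩
  have hexp : ∀ s, Complex.exp (ψ s - ψ' s) = 1 := by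
    intro s
    have hc : Continuous fun z : ℂ => Complex.exp (-z) := by fun_prop
    have h1 := tendsto_nhds_unique ((hc.tendsto _).comp (hψlim s))
      ((hlim s).comp (hns.comp hσ.tendsto_atTop))
    rw [sub_eq_add_neg, Complex.exp_add, h1, ← Complex.exp_add, add_neg_cancel, Complex.exp_zero]
  have hψ'0 : ψ' 0 = 0 :=
    (isIDExponent_of_tendsto (fun k => hg (ns (σ k))) (fun k => hc _) hψ' hψlim).2.1
  have h := eq_zero_of_exp_eq_one (hψ.sub hψ') (by simp [hψ0, hψ'0]) hexp t
  rw [Pi.sub_apply, sub_eq_zero] at h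
  rw [h]
  exact hψlim t

/-- The same norming sequences work, since convergence of the exponents themselves lets `φ` be
applied in the limit. -/
theorem DPA_subset_DPPhiA {μ : Measure ℝ≥0} [IsProbabilityMeasure μ] {f ψ : ℝ → ℂ}
    (h : Represents μ ψ f) : DPA (fun t => Complex.exp (-ψ t)) ⊆ DPPhiA μ f := by
  rintro g ⟨hg, n, a, b, hn, hnt, ha, hlim⟩
  refine ⟨hg, n, a, b, hn, hnt, ha, fun t => ?_⟩
  have hgk : ∀ k, IsCF (normed g (a k) (b k)) := fun k => hg.normed _ _
  have hck : ∀ k, (0 : ℝ) ≤ (n k : ℝ) := fun k => Nat.cast_nonneg _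
  have ht := tendsto_exponent_of_tendsto_exp hgk hck h.1.1 h.1.2.1 (by simpa using hlim) t
  have := tendsto_laplace (μ := μ) (fun k => ?_) ht
  · rw [h.2 t]
    simpa using this
  · rw [Complex.re_ofReal_mul, Complex.sub_re, Complex.one_re]
    exact mul_nonneg (hck _) (by linarith [(hgk k).re_le_one t])

theorem DPPhiA_eq_iUnion {μ : Measure ℝ≥0} [IsProbabilityMeasure μ] {f : ℝ → ℂ} (hf : IsCF f) :
    DPPhiA μ f = ⋃ ψ ∈ {ψ : ℝ → ℂ | Represents μ ψ f}, DPA (fun t => Complex.exp (-ψ t)) :=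
  (DPPhiA_subset hf).antisymm (Set.iUnion₂_subset fun _ h => DPA_subset_DPPhiA h)

theorem DPPhiA_eq_DPA {μ : Measure ℝ≥0} [IsProbabilityMeasure μ] {f ψ : ℝ → ℂ} (hf : IsCF f)
    (hψ : Represents μ ψ f) (huniq : HasUniquePhiInverse μ f) :
    DPPhiA μ f = DPA (fun t => Complex.exp (-ψ t)) := by
  refine subset_antisymm ?_ (DPA_subset_DPPhiA hψ)
  rw [DPPhiA_eq_iUnion hf]
  refine Set.iUnion₂_subset fun ψ' h => ?_
  rw [huniq ψ' ψ h hψ]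

end PhiAttraction

end

theorem theorem4p5 (μ : MeasureTheory.Measure NNReal) [MeasureTheory.IsProbabilityMeasure μ] :
    (∀ f : ℝ → ℂ, PhiAttraction.IsPhiID μ f →
      PhiAttraction.DPPhiA μ f =
        ⋃ ψ ∈ {ψ : ℝ → ℂ | PhiAttraction.Represents μ ψ f},
          PhiAttraction.DPA (fun t => Complex.exp (-ψ t))) ∧
    (∀ f ψ : ℝ → ℂ, PhiAttraction.IsPhiID μ f → PhiAttraction.Represents μ ψ f →
      PhiAttraction.HasUniquePhiInverse μ f →
      PhiAttraction.DPPhiA μ f = PhiAttraction.DPA (fun t => Complex.exp (-ψ t))) ∧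
    (∀ f ψ : ℝ → ℂ, PhiAttraction.IsPhiSemistable μ f →
      PhiAttraction.IsSemistableExponent ψ → PhiAttraction.Represents μ ψ f →
      PhiAttraction.HasUniquePhiInverse μ f →
      PhiAttraction.DPPhiA μ f = PhiAttraction.DPA (fun t => Complex.exp (-ψ t))) :=
  ⟨fun _ hf => PhiAttraction.DPPhiA_eq_iUnion hf.1,
    fun _ _ hf hψ huniq => PhiAttraction.DPPhiA_eq_DPA hf.1 hψ huniq,
    fun _ _ hf _ hψ huniq => PhiAttraction.DPPhiA_eq_DPA hf.1 hψ huniq⟩
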